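/- Fix $C>0$, $\beta\in(0,1)$, $R>0$ and $p\in(0,1)$. Consider a single TCP CUBIC connection with constant round trip time (RTT) $R$, no upper bound on the window size and no Reno mode, whose packets are lost independently of one another with probability $p$. Let $W'_n$ be the window size (in packets) at the last loss epoch, just before the reduction, let $T_n$ be the number of RTTs elapsed since that epoch, and let $W_n$ be the current window size. With integer window sizes of at least one packet, $$W_n=w(W'_n,T_n),\qquad w(z,d)=\max\Bigl\{1,\Bigl\lfloor C\Bigl(Rd-\sqrt[3]{\tfrac{\beta z}{C}}\Bigr)^3+z\Bigr\rfloor\Bigr\},$$ and $(W'_n,T_n)$ is the Markov chain on $\{1,2,\dots\}\times\{0,1,2,\dots\}$ which moves from $(z,d)$ to $(z,d+1)$ with probability $(1-p)^{w(z,d)}$ (no packet of the window is lost) and to $(w(z,d),0)$ with probability $1-(1-p)^{w(z,d)}$. Then this chain has a unique stationary distribution $\pi$, and the mean window size under stationarity is finite: $$\mathbb{E}[W(p)]=\sum_{z\ge 1,\,d\ge 0}w(z,d)\,\pi(z,d)<\infty .$$ -/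

import Mathlib

noncomputable section

namespace TCPCubic

open MeasureTheory ProbabilityTheory

/-- Every set of positive integers is measurable. -/
instance instMeasurableSpacePNat : MeasurableSpace ℕ+ := ⊤

instance instDiscreteMeasurableSpacePNat : DiscreteMeasurableSpace ℕ+ := ⟨fun _ => trivial⟩

/-- The real-valued CUBIC window `C (t - K)³ + W₀`, `K = (β W₀ / C)^(1/3)`, at time `t` after a
loss epoch, where `W₀` is the window size at that loss epoch (just before the reduction). -/
def cubicCurve (C β W₀ t : ℝ) : ℝ :=
  C * (t - (β * W₀ / C) ^ (1 / 3 : ℝ)) ^ 3 + W₀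

/-- A state `(z, d)` : `z` is the window size, in packets, at the last loss epoch, and `d` is the
time elapsed since then, in multiples of the round trip time. -/
abbrev State : Type := ℕ+ × ℕ

/-- The window size, in packets, in state `(z, d)` : the integer part of the CUBIC window at time
`R d` after the loss epoch, but always at least one packet. -/
def window (C β R : ℝ) (s : State) : ℕ+ :=
  ⟨max 1 ⌊cubicCurve C β (s.1 : ℕ) (R * s.2)⌋₊, lt_of_lt_of_le Nat.one_pos (le_max_left _ _)⟩

/-- The probability that none of the packets of the current window is lost, when packets are lost
independently with probability `p`. -/
def noLossProb (C β R p : ℝ) (s : State) : ℝ :=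
  (1 - p) ^ (window C β R s : ℕ)

/-- The one-step law from state `s = (z, d)` : without a loss the next state is `(z, d + 1)`; with
a loss it is `(w, 0)`, where `w` is the current window size. -/
def stepLaw (C β R p : ℝ) (s : State) : Measure State :=
  ENNReal.ofReal (noLossProb C β R p s) • Measure.dirac (s.1, s.2 + 1) +
    ENNReal.ofReal (1 - noLossProb C β R p s) • Measure.dirac (window C β R s, 0)

/-- The transition kernel of the Markov chain `(W'ₙ, Tₙ)`. -/
def stepKernel (C β R p : ℝ) : Kernel State State where
  toFun := stepLaw C β R p
  measurable' := measurable_of_countable _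

theorem isMarkovKernel_stepKernel (C β R : ℝ) {p : ℝ} (hp0 : 0 ≤ p) (hp1 : p ≤ 1) :
    IsMarkovKernel (stepKernel C β R p) := by
  refine ⟨fun s => ⟨?_⟩⟩
  have h0 : 0 ≤ noLossProb C β R p s := pow_nonneg (by linarith) _
  have h1 : noLossProb C β R p s ≤ 1 := pow_le_one₀ (by linarith) (by linarith)
  change stepLaw C β R p s Set.univ = 1
  simp only [stepLaw, Measure.add_apply, Measure.smul_apply, measure_univ, smul_eq_mul, mul_one]
  rw [← ENNReal.ofReal_add h0 (by linarith)]
  simp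

/-- `π` is a stationary distribution of the chain `(W'ₙ, Tₙ)`. -/
def IsStationary (C β R p : ℝ) (π : Measure State) : Prop :=
  IsProbabilityMeasure π ∧ (stepKernel C β R p).Invariant π

/-- The mean window size (possibly infinite) when the state has law `π`. -/
def meanWindow (C β R : ℝ) (π : Measure State) : ENNReal :=
  ∫⁻ s, ((window C β R s : ℕ) : ENNReal) ∂π

end TCPCubic

end

/-! The state `(1, 0)` is an atom. The occupation measure of an excursion from it, if finite, is
invariant, and every finite invariant measure is a multiple of it (`eq_smul_occupation`). So
everything reduces to a finite expected sum of windows over one excursion, which also bounds its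
mass because windows are at least 1. This is Foster's criterion (`lintegral_occupation_lt_top`) with
the window `w` as Lyapunov function. After a loss the next window is about `(1 - β) w`. Without one
it is at most `L w`, but this has probability `(1 - p) ^ w`, and `(1 - p) ^ w * w` is bounded. Hence
the mean next window is at most `(1 - β) w + b`. From bounded windows, successive losses lead to
`(1, 0)` with probability bounded below. -/

namespace TabooChain

open MeasureTheory ProbabilityTheory ENNReal

/-! ### Excursions from an atom of a Markov chain -/

variable {α : Type*} [MeasurableSpace α] [DiscreteMeasurableSpace α]

/-- The kernel `κ` killed when it enters `a`. -/
noncomputable def taboo (κ : Kernel α α) (a : α) : Kernel α α :=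
  κ.restrict (measurableSet_singleton a).compl

/-- The law of the `n`-th state of the chain started at `a`, on the event that it has not
returned to `a` by then. -/
noncomputable def excursion (κ : Kernel α α) (a : α) : ℕ → Measure α
  | 0 => Measure.dirac a
  | n + 1 => (excursion κ a n).bind (taboo κ a)

/-- The expected occupation measure of an excursion from `a`. -/
noncomputable def occupation (κ : Kernel α α) (a : α) : Measure α :=
  Measure.sum (excursion κ a)

/-- The probability that the chain does not visit `a` at any of the times `1, …, n`. -/
noncomputable def survival (κ : Kernel α α) (a : α) : ℕ → α → ℝ≥0∞
  | 0 => fun _ => 1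
  | n + 1 => fun s => ∫⁻ x, survival κ a n x ∂taboo κ a s

variable {κ : Kernel α α} {a : α}

theorem bind_taboo (μ : Measure α) :
    μ.bind (taboo κ a) = (μ.bind κ).restrict {a}ᶜ := by
  ext s hs
  rw [Measure.restrict_apply hs, Measure.bind_apply hs (Kernel.aemeasurable _),
    Measure.bind_apply (.of_discrete) (Kernel.aemeasurable _)]
  simp only [taboo, Kernel.restrict_apply' _ _ _ hs]

theorem lintegral_taboo_le (f : α → ℝ≥0∞) (s : α) :
    ∫⁻ x, f x ∂taboo κ a s ≤ ∫⁻ x, f x ∂κ s := by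
  rw [taboo, Kernel.lintegral_restrict]
  exact setLIntegral_le_lintegral _ _

theorem lintegral_taboo (f : α → ℝ≥0∞) (s : α) :
    ∫⁻ x, f x ∂taboo κ a s = ∫⁻ x, ({a}ᶜ : Set α).indicator f x ∂κ s := by
  rw [taboo, Kernel.lintegral_restrict, lintegral_indicator (measurableSet_singleton a).compl]

theorem survival_le_one [IsMarkovKernel κ] (n : ℕ) (s : α) : survival κ a n s ≤ 1 := by
  induction n generalizing s with
  | zero => exact le_rfl
  | succ n ih =>
    calc ∫⁻ x, survival κ a n x ∂taboo κ a s ≤ ∫⁻ x, survival κ a n x ∂κ s := lintegral_taboo_le _ _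
      _ ≤ ∫⁻ _, 1 ∂κ s := lintegral_mono fun x => ih x
      _ = 1 := by simp

theorem lintegral_bind_taboo (μ : Measure α) (f : α → ℝ≥0∞) :
    ∫⁻ x, f x ∂μ.bind (taboo κ a) = ∫⁻ s, ∫⁻ x, f x ∂taboo κ a s ∂μ :=
  Measure.lintegral_bind (Kernel.aemeasurable _) (Measurable.of_discrete).aemeasurable

/-- A Lyapunov function for the killed chain bounds the expected cost of an excursion. -/
theorem lintegral_occupation_le {V f : α → ℝ≥0∞}
    (h : ∀ s, ∫⁻ x, V x ∂taboo κ a s + f s ≤ V s) :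
    ∫⁻ s, f s ∂occupation κ a ≤ V a := by
  rw [occupation, lintegral_sum_measure, ENNReal.tsum_eq_iSup_nat]
  refine iSup_le fun N => ?_
  -- Keeping the value of `V` at time `N` makes the sum telescope.
  suffices H : ∑ n ∈ Finset.range N, ∫⁻ s, f s ∂excursion κ a n
      + ∫⁻ s, V s ∂excursion κ a N ≤ V a from le_self_add.trans H
  induction N with
  | zero => simp [excursion]
  | succ N ih =>
    rw [Finset.sum_range_succ, excursion, lintegral_bind_taboo, add_assoc,
      ← lintegral_add_left .of_discrete]
    refine le_trans ?_ ih
    gcongr with s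
    rw [add_comm]
    exact h s

theorem occupation_eq : occupation κ a = Measure.dirac a + (occupation κ a).bind (taboo κ a) := by
  rw [occupation, Measure.bind_sum _ _ (Kernel.aemeasurable _)]
  ext s hs
  rw [Measure.add_apply, Measure.sum_apply _ hs, Measure.sum_apply _ hs,
    tsum_eq_zero_add' ENNReal.summable]
  simp only [excursion]

theorem occupation_singleton : occupation κ a {a} = 1 := by
  rw [occupation_eq, bind_taboo]
  simp [Measure.restrict_apply]

theorem restrict_occupation :
    (occupation κ a).restrict {a}ᶜ = ((occupation κ a).bind κ).restrict {a}ᶜ := by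
  conv_lhs => rw [occupation_eq, bind_taboo]
  ext s hs
  simp [Measure.restrict_apply, hs]

/-- Equal total mass settles the one remaining point; finiteness permits the cancellation. -/
theorem measure_eq_of_restrict {μ ν : Measure α} [IsFiniteMeasure μ]
    (h : μ.restrict {a}ᶜ = ν.restrict {a}ᶜ) (hu : ν Set.univ = μ Set.univ) : μ = ν := by
  have hc : μ {a}ᶜ = ν {a}ᶜ := by
    simpa using congrArg (fun m : Measure α => m Set.univ) h
  have hs : μ {a} = ν {a} := by
    have h1 := measure_add_measure_compl (μ := μ) (measurableSet_singleton a)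
    have h2 := measure_add_measure_compl (μ := ν) (measurableSet_singleton a)
    rw [hu, ← h1, ← hc] at h2
    exact ((ENNReal.add_left_inj (measure_ne_top μ _)).1 h2).symm
  rw [← Measure.restrict_add_restrict_compl (μ := μ) (measurableSet_singleton a),
    ← Measure.restrict_add_restrict_compl (μ := ν) (measurableSet_singleton a), h,
    Measure.restrict_singleton, Measure.restrict_singleton, hs]

theorem invariant_occupation [IsMarkovKernel κ] [IsFiniteMeasure (occupation κ a)] :
    κ.Invariant (occupation κ a) := by
  refine (measure_eq_of_restrict restrict_occupation ?_).symm
  simp [Measure.bind_apply .univ (Kernel.aemeasurable _)]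

theorem sum_excursion_succ (N : ℕ) :
    ∑ n ∈ Finset.range (N + 1), excursion κ a n
      = Measure.dirac a + (∑ n ∈ Finset.range N, excursion κ a n).bind (taboo κ a) := by
  induction N with
  | zero => simp [excursion]
  | succ N ih =>
    conv_lhs => rw [Finset.sum_range_succ, ih]
    rw [Finset.sum_range_succ, Measure.comp_add, add_assoc, excursion]

theorem bind_mono_left {β : Type*} [MeasurableSpace β] {μ ν : Measure β} (h : μ ≤ ν)
    (η : Kernel β β) : μ.bind η ≤ ν.bind η := by
  refine Measure.le_iff.2 fun s hs => ?_
  rw [Measure.bind_apply hs (Kernel.aemeasurable _), Measure.bind_apply hs (Kernel.aemeasurable _)]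
  exact lintegral_mono' h le_rfl

/-- Invariance splits as `π = π {a} • δ_a + π.bind (taboo κ a)`; iterating it puts each partial sum
of excursion laws below `π`. -/
theorem smul_occupation_le {π : Measure α} (h : κ.Invariant π) :
    π {a} • occupation κ a ≤ π := by
  have key : ∀ N : ℕ, π {a} • ∑ n ∈ Finset.range N, excursion κ a n ≤ π := by
    intro N
    induction N with
    | zero => simp [Measure.zero_le]
    | succ N ih =>
      rw [sum_excursion_succ, smul_add, ← Measure.bind_smul, ← Measure.restrict_singleton]
      calc _ ≤ π.restrict {a} + π.bind (taboo κ a) := by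
            gcongr
            exact bind_mono_left ih _
        _ = π := by
            rw [bind_taboo, h.def,
              Measure.restrict_add_restrict_compl (measurableSet_singleton a)]
  refine Measure.le_iff.2 fun s hs => ?_
  rw [Measure.smul_apply, occupation, Measure.sum_apply _ hs, ENNReal.tsum_eq_iSup_nat,
    smul_eq_mul, ENNReal.mul_iSup]
  refine iSup_le fun N => ?_
  simpa using key N s

/-- With no mass at `a`, `σ` is invariant for the killed kernel too, so nothing is ever killed and
every survival probability is 1 almost everywhere. -/
theorem eq_zero_of_invariant [IsMarkovKernel κ] {σ : Measure α} [IsFiniteMeasure σ]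
    (h : κ.Invariant σ) (ha : σ {a} = 0)
    (hreach : ∀ s, ∃ n, survival κ a n s < 1) : σ = 0 := by
  have hσ : σ.bind (taboo κ a) = σ := by
    rw [bind_taboo, h.def, Measure.restrict_eq_self_of_ae_mem]
    rw [ae_iff]; simpa using ha
  have hint : ∀ n, ∫⁻ s, survival κ a n s ∂σ = σ Set.univ := by
    intro n
    induction n with
    | zero => simp [survival]
    | succ n ih =>
      rw [← ih]
      conv_rhs => rw [← hσ, lintegral_bind_taboo]
      rfl
  have hae : ∀ n, ∀ᵐ s ∂σ, survival κ a n s = 1 := fun n =>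
    ae_eq_of_ae_le_of_lintegral_le (.of_forall (survival_le_one n))
      (by rw [hint]; exact measure_ne_top _ _) aemeasurable_const (by rw [hint]; simp)
  rw [← Measure.measure_univ_eq_zero]
  have : ∀ᵐ s ∂σ, False := by
    filter_upwards [ae_all_iff.2 hae] with s hs
    obtain ⟨n, hn⟩ := hreach s
    exact hn.ne (hs n)
  simpa [ae_iff] using this

/-- The occupation measure gives `a` mass 1, so the excess of `π` over its multiple is an invariant
measure without mass at `a`, hence zero. -/
theorem eq_smul_occupation [IsMarkovKernel κ] [IsFiniteMeasure (occupation κ a)]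
    {π : Measure α} [IsFiniteMeasure π] (h : κ.Invariant π)
    (hreach : ∀ s, ∃ n, survival κ a n s < 1) : π = π {a} • occupation κ a := by
  set μ := π {a} • occupation κ a with hμ
  have : IsFiniteMeasure μ := Measure.smul_finite _ (measure_ne_top _ _)
  have hle : μ ≤ π := smul_occupation_le h
  have hadd : π - μ + μ = π := Measure.sub_add_cancel_of_le hle
  have hμinv : κ.Invariant μ := by
    rw [Kernel.Invariant, hμ, Measure.bind_smul, invariant_occupation.def]
  have hinv : κ.Invariant (π - μ) := by
    have h1 : (π - μ).bind κ + μ = π - μ + μ := by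
      nth_rw 2 [← hμinv.def]
      rw [← Measure.comp_add, hadd, h.def]
    ext s hs
    have h2 := congrArg (fun m : Measure α => m s) h1
    exact (ENNReal.add_left_inj (measure_ne_top μ s)).1 h2
  have hz : (π - μ) {a} = 0 := by
    rw [Measure.sub_apply (measurableSet_singleton a) hle, hμ]
    simp [occupation_singleton]
  have : IsFiniteMeasure (π - μ) := ⟨(Measure.sub_le _).trans_lt (measure_lt_top π _)⟩
  rw [← hadd, eq_zero_of_invariant hinv hz hreach, zero_add]

/-- Foster's criterion with an accessible atom: a drift condition `κ W + 2 f ≤ W + M` for a cost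
`f ≥ 1` makes the expected cost of an excursion finite, provided that the atom is reached from the
states of cost at most `M` within a fixed number of steps with probability bounded below. -/
theorem lintegral_occupation_lt_top [IsMarkovKernel κ] {W f : α → ℝ≥0∞} {M ε : ℝ≥0∞} {N : ℕ}
    (hM : M ≠ ⊤) (hε : ε ≠ 0) (hε1 : ε ≠ ⊤) (hf : ∀ s, f s ≠ ⊤) (hW : W a ≠ ⊤)
    (hdrift : ∀ s, ∫⁻ x, W x ∂κ s + 2 * f s ≤ W s + M)
    (hreach : ∀ s, f s ≤ M → survival κ a N s + ε ≤ 1) :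
    ∫⁻ s, f s ∂occupation κ a < ⊤ := by
  -- `H` is the expected minimum of `N` and the hitting time of `a`. A killed step lowers it by `1 -
  -- survival κ a N s`, which is at least `ε` where `f ≤ M`.
  set H : α → ℝ≥0∞ := fun s => ∑ k ∈ Finset.range N, survival κ a k s with hH
  have hHfin : ∀ s, H s ≠ ⊤ := fun s =>
    ENNReal.sum_ne_top.2 fun k _ => ((survival_le_one k s).trans_lt one_lt_top).ne
  have hHstep : ∀ s, ∫⁻ x, H x ∂taboo κ a s + 1 = H s + survival κ a N s := by
    intro s
    rw [hH, lintegral_finsetSum _ fun _ _ => Measurable.of_discrete]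
    exact (Finset.sum_range_succ' (fun k => survival κ a k s) N).symm.trans
      (Finset.sum_range_succ (fun k => survival κ a k s) N)
  have hHle : ∀ s, ∫⁻ x, H x ∂taboo κ a s ≤ H s := fun s =>
    (ENNReal.add_le_add_iff_right one_ne_top).1
      ((hHstep s).le.trans (by gcongr; exact survival_le_one N s))
  have hHlt : ∀ s, f s ≤ M → ∫⁻ x, H x ∂taboo κ a s + ε ≤ H s := by
    intro s hs
    refine (ENNReal.add_le_add_iff_right one_ne_top).1 ?_
    calc ∫⁻ x, H x ∂taboo κ a s + ε + 1 = (∫⁻ x, H x ∂taboo κ a s + 1) + ε := by ring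
      _ = H s + (survival κ a N s + ε) := by rw [hHstep, add_assoc]
      _ ≤ H s + 1 := by gcongr; exact hreach s hs
  have hB : M / ε * ε = M := ENNReal.div_mul_cancel hε hε1
  -- Where `f ≤ M`, the drop of `M / ε * H` pays for the constant `M`; where `f ≥ M`, one of the two
  -- copies of `f` does.
  refine (lintegral_occupation_le (V := fun s => W s + M / ε * H s) fun s => ?_).trans_lt ?_
  · rw [lintegral_add_left Measurable.of_discrete, lintegral_const_mul _ Measurable.of_discrete]
    have hW' : ∫⁻ x, W x ∂taboo κ a s + 2 * f s ≤ W s + M :=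
      le_trans (add_le_add_left (lintegral_taboo_le W s) _) (hdrift s)
    rcases le_total (f s) M with hs | hs
    · refine (ENNReal.add_le_add_iff_right hM).1 ?_
      calc ∫⁻ x, W x ∂taboo κ a s + M / ε * ∫⁻ x, H x ∂taboo κ a s + f s + M
          = (∫⁻ x, W x ∂taboo κ a s + f s) + M / ε * (∫⁻ x, H x ∂taboo κ a s + ε) := by
            rw [mul_add, hB]; ring
        _ ≤ (∫⁻ x, W x ∂taboo κ a s + 2 * f s) + M / ε * H s := by
            gcongr
            · exact le_mul_of_one_le_left' one_le_two
            · exact hHlt s hs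
        _ ≤ (W s + M) + M / ε * H s := by gcongr
        _ = W s + M / ε * H s + M := by ring
    · have h1 : ∫⁻ x, W x ∂taboo κ a s + f s ≤ W s := by
        refine (ENNReal.add_le_add_iff_right (hf s)).1 ?_
        calc _ = ∫⁻ x, W x ∂taboo κ a s + 2 * f s := by ring
          _ ≤ W s + M := hW'
          _ ≤ _ := by gcongr
      calc _ = (∫⁻ x, W x ∂taboo κ a s + f s) + M / ε * ∫⁻ x, H x ∂taboo κ a s := by ring
        _ ≤ _ := by gcongr; exact hHle s
  · exact (ENNReal.add_lt_top.2 ⟨hW.lt_top, ENNReal.mul_lt_top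
      (ENNReal.div_lt_top hM hε) (hHfin a).lt_top⟩)

end TabooChain

namespace TCPCubic

open MeasureTheory ProbabilityTheory ENNReal TabooChain

theorem lintegral_stepKernel (C β R p : ℝ) (f : State → ℝ≥0∞) (s : State) :
    ∫⁻ x, f x ∂stepKernel C β R p s
      = ENNReal.ofReal (noLossProb C β R p s) * f (s.1, s.2 + 1)
        + ENNReal.ofReal (1 - noLossProb C β R p s) * f (window C β R s, 0) := by
  change ∫⁻ x, f x ∂stepLaw C β R p s = _
  simp [stepLaw, lintegral_add_measure, lintegral_smul_measure]

/-! ### Growth and reduction of the CUBIC window -/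

section Window

variable {C β R : ℝ}

theorem window_coe (s : State) :
    ((window C β R s : ℕ) : ℝ) = max 1 (⌊cubicCurve C β (s.1 : ℕ) (R * s.2)⌋₊ : ℝ) := by
  simp [window]

theorem one_le_window (s : State) : (1 : ℝ) ≤ (window C β R s : ℕ) := by
  exact_mod_cast (window C β R s).pos

theorem cubicCurve_lt_window_add_one (s : State) :
    cubicCurve C β (s.1 : ℕ) (R * s.2) < (window C β R s : ℕ) + 1 := by
  rw [window_coe]
  exact (Nat.lt_floor_add_one _).trans_le (by gcongr; exact le_max_right _ _)

theorem window_le {s : State} {y : ℝ} (hy : 1 ≤ y)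
    (h : cubicCurve C β (s.1 : ℕ) (R * s.2) ≤ y) : ((window C β R s : ℕ) : ℝ) ≤ y := by
  rw [window_coe]
  refine max_le hy ?_
  rcases le_total 0 (cubicCurve C β (s.1 : ℕ) (R * s.2)) with h0 | h0
  · exact (Nat.floor_le h0).trans h
  · rw [Nat.floor_of_nonpos h0]; norm_num; linarith

theorem cbrt_pow_three {x : ℝ} (hx : 0 ≤ x) : (x ^ (1 / 3 : ℝ)) ^ 3 = x := by
  rw [← Real.rpow_natCast, ← Real.rpow_mul hx]; norm_num

theorem window_zero_le (hC : 0 < C) (hβ0 : 0 < β) (z : ℕ+) :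
    ((window C β R (z, 0) : ℕ) : ℝ) ≤ max 1 ((1 - β) * (z : ℕ)) := by
  refine window_le (le_max_left _ _) (le_trans (le_of_eq ?_) (le_max_right _ _))
  have h := cbrt_pow_three (x := β * (z : ℕ) / C) (by positivity)
  simp only [cubicCurve, Nat.cast_zero, mul_zero, zero_sub]
  rw [Odd.neg_pow (by decide), h]
  field_simp
  ring

theorem window_zero_lt (hC : 0 < C) (hβ0 : 0 < β) (hβ1 : β < 1) {z : ℕ+} (hz : z ≠ 1) :
    window C β R (z, 0) < z := by
  have hz2 : (1 : ℝ) < (z : ℕ) := by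
    exact_mod_cast (one_lt_iff_ne_one.2 hz : (1 : ℕ+) < z)
  have h : ((window C β R (z, 0) : ℕ) : ℝ) < (z : ℕ) :=
    (window_zero_le hC hβ0 z).trans_lt (max_lt hz2 (by nlinarith))
  exact_mod_cast h

theorem add_pow_three_le {x r : ℝ} (hr : 0 ≤ r) : (x + r) ^ 3 ≤ 4 * max x 0 ^ 3 + 4 * r ^ 3 := by
  have hx := le_max_right x 0
  calc (x + r) ^ 3 ≤ (max x 0 + r) ^ 3 :=
        (Odd.strictMono_pow (by decide : Odd 3)).monotone (by gcongr; exact le_max_left _ _)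
    -- With `m = max x 0`, the difference of the two sides is `3 (m + r) (m - r)²`.
    _ ≤ _ := by nlinarith [mul_nonneg (add_nonneg hx hr) (sq_nonneg (max x 0 - r))]

/-- In one round trip time without losses the window grows at most by a constant factor. -/
theorem window_succ_le (hC : 0 < C) (hβ0 : 0 < β) (hβ1 : β < 1) (hR : 0 < R) (z : ℕ+) (d : ℕ) :
    ((window C β R (z, d + 1) : ℕ) : ℝ)
      ≤ (8 + 4 * C * R ^ 3 + 2 / (1 - β)) * (window C β R (z, d) : ℕ) := by
  have hb : 0 < 1 - β := by linarith
  set w : ℝ := ((window C β R (z, d) : ℕ) : ℝ) with hw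
  have hw1 : 1 ≤ w := one_le_window _
  set k : ℝ := (β * (z : ℕ) / C) ^ (1 / 3 : ℝ) with hk
  have hk3 : C * k ^ 3 = β * (z : ℕ) := by
    rw [hk, cbrt_pow_three (by positivity)]; field_simp
  set x : ℝ := R * d - k with hx
  have hcur : C * x ^ 3 + (z : ℕ) < w + 1 := cubicCurve_lt_window_add_one (z, d)
  have hz0 : (0 : ℝ) ≤ (z : ℕ) := Nat.cast_nonneg _
  -- The factor 4 of `add_pow_three_le` turns this bound into the 8 of the constant.
  have hmax : C * max x 0 ^ 3 ≤ 2 * w := by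
    rcases le_total x 0 with h | h
    · rw [max_eq_right h]; norm_num; linarith
    · rw [max_eq_left h]; linarith
  -- The curve is lowest at time 0, where it equals `(1 - β) z`.
  have hz : (z : ℕ) ≤ 2 / (1 - β) * w := by
    have hxk : (-k) ^ 3 ≤ x ^ 3 :=
      (Odd.strictMono_pow (by decide : Odd 3)).monotone (by rw [hx]; nlinarith [d.cast_nonneg (α := ℝ)])
    rw [Odd.neg_pow (by decide)] at hxk
    have h1 : (1 - β) * (z : ℕ) ≤ 2 * w := by nlinarith
    rw [div_mul_eq_mul_div, le_div_iff₀ hb]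
    linarith
  have hbw : 0 ≤ 2 / (1 - β) * w := by positivity
  have hCR : 0 < C * R ^ 3 := by positivity
  have hCRw : C * R ^ 3 ≤ C * R ^ 3 * w := le_mul_of_one_le_right hCR.le hw1
  refine window_le (by nlinarith) ?_
  have hx1 : R * ((d + 1 : ℕ) : ℝ) - k = x + R := by rw [hx]; push_cast; ring
  simp only [cubicCurve]
  rw [← hk, hx1]
  have h3 := mul_le_mul_of_nonneg_left (add_pow_three_le (x := x) hR.le) hC.le
  nlinarith

end Window

/-- Bernoulli's inequality for `(1 + p) ^ n`, together with `(1 - p) (1 + p) ≤ 1`. -/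
theorem nat_mul_one_sub_pow_le {p : ℝ} (hp0 : 0 < p) (hp1 : p < 1) (n : ℕ) :
    (1 - p) ^ n * n ≤ 1 / p := by
  have h1 : 1 + n * p ≤ (1 + p) ^ n := one_add_mul_le_pow (by linarith) n
  have h2 : (1 - p) ^ n * (1 + p) ^ n ≤ 1 := by
    rw [← mul_pow]; exact pow_le_one₀ (by nlinarith) (by nlinarith)
  have h3 : 0 ≤ (1 - p) ^ n := pow_nonneg (by linarith) n
  rw [le_div_iff₀ hp0]
  nlinarith

/-! ### Drift of the window and access to the atom -/

section Drift

variable {C β R p : ℝ}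

theorem noLossProb_nonneg (hp1 : p < 1) (s : State) : 0 ≤ noLossProb C β R p s :=
  pow_nonneg (by linarith) _

theorem noLossProb_le (hp0 : 0 < p) (hp1 : p < 1) (s : State) :
    noLossProb C β R p s ≤ 1 - p :=
  pow_le_of_le_one (by linarith) (by linarith) (PNat.ne_zero _)

/-- The window size contracts by the factor `1 - β` on average, up to an additive constant. -/
theorem exists_window_drift (hC : 0 < C) (hβ0 : 0 < β) (hβ1 : β < 1) (hR : 0 < R)
    (hp0 : 0 < p) (hp1 : p < 1) :
    ∃ b : ℝ, 0 ≤ b ∧ ∀ s : State,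
      noLossProb C β R p s * (window C β R (s.1, s.2 + 1) : ℕ)
        + (1 - noLossProb C β R p s) * (window C β R (window C β R s, 0) : ℕ)
      ≤ (1 - β) * (window C β R s : ℕ) + b := by
  have hb : 0 < 1 - β := by linarith
  set L : ℝ := 8 + 4 * C * R ^ 3 + 2 / (1 - β) with hL
  have hL0 : 0 ≤ L := by positivity
  -- `L / p` bounds the loss-free term; the 1 covers the minimum of one packet.
  refine ⟨L * (1 / p) + 1, by positivity, fun s => ?_⟩
  set w : ℕ := (window C β R s : ℕ) with hw
  have hq0 := noLossProb_nonneg (C := C) (β := β) (R := R) hp1 s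
  have hq1 := noLossProb_le (C := C) (β := β) (R := R) hp0 hp1 s
  have h1 : noLossProb C β R p s * (window C β R (s.1, s.2 + 1) : ℕ) ≤ L * (1 / p) := by
    calc _ ≤ noLossProb C β R p s * (L * w) := by
          gcongr; exact window_succ_le hC hβ0 hβ1 hR s.1 s.2
      _ = L * ((1 - p) ^ w * w) := by rw [noLossProb]; ring
      _ ≤ _ := by gcongr; exact nat_mul_one_sub_pow_le hp0 hp1 w
  have hnn : 0 ≤ (1 - β) * (w : ℝ) := by positivity
  have h2 : ((window C β R (window C β R s, 0) : ℕ) : ℝ) ≤ (1 - β) * w + 1 :=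
    (window_zero_le hC hβ0 _).trans (max_le (by linarith) (by linarith))
  have h3 : (1 - noLossProb C β R p s) * (window C β R (window C β R s, 0) : ℕ)
      ≤ (1 - β) * w + 1 :=
    (mul_le_of_le_one_left (Nat.cast_nonneg _) (by linarith)).trans h2
  linarith

/-- From a state with window size at most `N`, the state `(1, 0)` is reached by at most `N`
successive losses. -/
theorem survival_le (hC : 0 < C) (hβ0 : 0 < β) (hβ1 : β < 1)
    (hp0 : 0 < p) (hp1 : p < 1) (N : ℕ) (s : State) (hs : (window C β R s : ℕ) ≤ N) :
    survival (stepKernel C β R p) (1, 0) N s ≤ ENNReal.ofReal (1 - p ^ N) := by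
  have := isMarkovKernel_stepKernel C β R hp0.le hp1.le
  induction N generalizing s with
  | zero => exact absurd hs (by simp)
  | succ N ih =>
    have hq0 := noLossProb_nonneg (C := C) (β := β) (R := R) hp1 s
    have hq1 := noLossProb_le (C := C) (β := β) (R := R) hp0 hp1 s
    have hpN : 0 ≤ p ^ N := by positivity
    have hpN1 : p ^ N ≤ 1 := pow_le_one₀ hp0.le hp1.le
    rw [survival]
    beta_reduce
    rw [lintegral_taboo, lintegral_stepKernel]
    set q := noLossProb C β R p s with hq
    have h1 : ({(1, 0)}ᶜ : Set State).indicator (survival (stepKernel C β R p) (1, 0) N)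
        (s.1, s.2 + 1) ≤ 1 :=
      Set.indicator_le' (fun x _ => survival_le_one N x) (fun _ _ => zero_le_one) _
    have h2 : ({(1, 0)}ᶜ : Set State).indicator (survival (stepKernel C β R p) (1, 0) N)
        (window C β R s, 0) ≤ ENNReal.ofReal (1 - p ^ N) := by
      by_cases hw : window C β R s = 1
      -- A loss at window 1 leads to the atom itself, where the killed chain has no mass.
      · simp [hw]
      · refine (Set.indicator_le_self _ _ _).trans (ih _ ?_)
        have := window_zero_lt (R := R) hC hβ0 hβ1 hw
        have : (window C β R (window C β R s, 0) : ℕ) < window C β R s := by exact_mod_cast this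
        omega
    calc _ ≤ ENNReal.ofReal q * 1 + ENNReal.ofReal (1 - q) * ENNReal.ofReal (1 - p ^ N) := by
          gcongr
      _ = ENNReal.ofReal (q + (1 - q) * (1 - p ^ N)) := by
          rw [mul_one, ← ENNReal.ofReal_mul (by linarith), ← ENNReal.ofReal_add hq0]
          exact mul_nonneg (by linarith) (by linarith)
      _ ≤ _ := by
          -- The left side is `1 - (1 - q) p ^ N`, and `1 - q ≥ p`.
          refine ENNReal.ofReal_le_ofReal ?_
          rw [pow_succ]
          nlinarith

/-- The expected sum of the window sizes between two visits to `(1, 0)` is finite. -/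
theorem lintegral_window_occupation_lt_top (hC : 0 < C) (hβ0 : 0 < β) (hβ1 : β < 1) (hR : 0 < R)
    (hp0 : 0 < p) (hp1 : p < 1) :
    ∫⁻ s, ((window C β R s : ℕ) : ℝ≥0∞) ∂occupation (stepKernel C β R p) (1, 0) < ⊤ := by
  have := isMarkovKernel_stepKernel C β R hp0.le hp1.le
  obtain ⟨b, hb0, hb⟩ := exists_window_drift hC hβ0 hβ1 hR hp0 hp1
  -- Scaling by `2 / β` turns the contraction gap `β w` into the required `2 w`. `M` serves as drift
  -- constant, threshold and number of steps.
  obtain ⟨M, hM⟩ := exists_nat_ge (2 / β * b)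
  refine lintegral_occupation_lt_top
    (W := fun s => ENNReal.ofReal (2 / β * (window C β R s : ℕ))) (M := M) (N := M)
    (ε := ENNReal.ofReal (p ^ M)) (natCast_ne_top M)
    (ENNReal.ofReal_pos.2 (by positivity)).ne' ofReal_ne_top (fun s => natCast_ne_top _)
    ofReal_ne_top (fun s => ?_) fun s hs => ?_
  · have hq0 := noLossProb_nonneg (C := C) (β := β) (R := R) hp1 s
    have hq1 : 0 ≤ 1 - noLossProb C β R p s := by
      linarith [noLossProb_le (C := C) (β := β) (R := R) hp0 hp1 s]
    rw [lintegral_stepKernel, ← ENNReal.ofReal_mul hq0, ← ENNReal.ofReal_mul hq1,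
      ← ENNReal.ofReal_add (by positivity) (by positivity), ← ENNReal.ofReal_natCast,
      ← ENNReal.ofReal_natCast M, ← ENNReal.ofReal_ofNat, ← ENNReal.ofReal_mul (by norm_num),
      ← ENNReal.ofReal_add (by positivity) (by positivity),
      ← ENNReal.ofReal_add (by positivity) (by positivity)]
    refine ENNReal.ofReal_le_ofReal ?_
    have h := mul_le_mul_of_nonneg_left (hb s) (by positivity : 0 ≤ 2 / β)
    have h2 : 2 / β * ((1 - β) * (window C β R s : ℕ))
        = 2 / β * (window C β R s : ℕ) - 2 * (window C β R s : ℕ) := by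
      field_simp
    rw [mul_add, mul_add, h2] at h
    linarith
  · have hp : p ^ M ≤ 1 := pow_le_one₀ hp0.le hp1.le
    calc _ ≤ ENNReal.ofReal (1 - p ^ M) + ENNReal.ofReal (p ^ M) := by
          gcongr
          exact survival_le hC hβ0 hβ1 hp0 hp1 M s (by exact_mod_cast hs)
      _ = 1 := by
          rw [← ENNReal.ofReal_add (by linarith) (by positivity)]
          simp

end Drift

end TCPCubic

/-! ### Normalising the occupation measure -/

open MeasureTheory ProbabilityTheory TCPCubic TabooChain in
theorem mainTheorem6 (C β R p : ℝ) (hC : 0 < C) (hβ0 : 0 < β) (hβ1 : β < 1) (hR : 0 < R)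
    (hp0 : 0 < p) (hp1 : p < 1) :
    ∃ π : MeasureTheory.Measure TCPCubic.State,
      (TCPCubic.IsStationary C β R p π ∧
        ∀ π' : MeasureTheory.Measure TCPCubic.State,
          TCPCubic.IsStationary C β R p π' → π' = π) ∧
      TCPCubic.meanWindow C β R π < ⊤ := by
  have := isMarkovKernel_stepKernel C β R hp0.le hp1.le
  set μ := occupation (stepKernel C β R p) (1, 0) with hμ
  have hint : ∫⁻ s, ((window C β R s : ℕ) : ENNReal) ∂μ < ⊤ :=
    lintegral_window_occupation_lt_top hC hβ0 hβ1 hR hp0 hp1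
  have hfin : IsFiniteMeasure μ := by
    refine ⟨lt_of_le_of_lt ?_ hint⟩
    rw [← lintegral_one]
    refine lintegral_mono fun s => ?_
    beta_reduce
    exact_mod_cast (window C β R s).pos
  have hpos : μ Set.univ ≠ 0 := fun h => by
    have h1 : μ {(1, 0)} = 1 := occupation_singleton
    rw [measure_mono_null (Set.subset_univ _) h] at h1
    exact zero_ne_one h1
  have hreach : ∀ s, ∃ n, survival (stepKernel C β R p) (1, 0) n s < 1 := fun s => by
    refine ⟨_, (survival_le hC hβ0 hβ1 hp0 hp1 _ s le_rfl).trans_lt ?_⟩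
    rw [ENNReal.ofReal_lt_one]
    linarith [pow_pos hp0 (window C β R s : ℕ)]
  refine ⟨(μ Set.univ)⁻¹ • μ, ⟨⟨⟨?_⟩, ?_⟩, ?_⟩, ?_⟩
  · simpa using ENNReal.inv_mul_cancel hpos (measure_ne_top μ _)
  · rw [Kernel.Invariant, Measure.bind_smul, invariant_occupation.def]
  · rintro π' ⟨hprob, hinv⟩
    have h := eq_smul_occupation hinv hreach
    have hu := congrArg (fun m : Measure State => m Set.univ) h
    simp only [measure_univ, Measure.smul_apply, smul_eq_mul] at hu
    -- Total mass 1 forces the multiple to be `(μ Set.univ)⁻¹`.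
    rw [← ENNReal.eq_inv_of_mul_eq_one_left hu.symm]
    exact h
  · rw [meanWindow, lintegral_smul_measure, smul_eq_mul]
    exact ENNReal.mul_lt_top (ENNReal.inv_lt_top.2 (pos_iff_ne_zero.2 hpos)) hint
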